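/- Call a field $K$ \emph{pythagorean} if every finite sum of squares in $K$ is a square in $K$, \emph{quadratically closed} if every element of $K$ is a square in $K$, and \emph{hereditarily non-pythagorean} if every proper finite field extension $F/K$ that is not purely inseparable is such that $F$ is not pythagorean. \textbf{Theorem.} Let $E$ be a field of characteristic different from $2$ that is finitely generated (as a field) and of transcendence degree at least one over some subfield. Let $E_0/E$ be a (possibly infinite) Galois extension such that $E_0$ is pythagorean or quadratically closed. Then $E_0$ is hereditarily non-pythagorean. -/

import Mathlib

universe u

/-- A field is pythagorean if every (finite) sum of squares is a square. -/
def IsPythagoreanField (K : Type u) [Field K] : Prop :=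
  ∀ a : K, IsSumSq a → IsSquare a

/-- A field is quadratically closed if every element is a square. -/
def IsQuadraticallyClosedField (K : Type u) [Field K] : Prop :=
  ∀ a : K, IsSquare a

/-- A field `k` is hereditarily non-pythagorean if every proper finite extension `F / k` that is
not purely inseparable is non-pythagorean. Every finite extension of `k` is isomorphic over `k` to
one in the universe of `k`, so no extension is lost by taking `F` there. -/
def IsHereditarilyNonPythagorean (k : Type u) [Field k] : Prop :=
  ∀ (F : Type u) [Field F] [Algebra k F], FiniteDimensional k F →
    ¬ Function.Surjective (algebraMap k F) → ¬ IsPurelyInseparable k F →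
      ¬ IsPythagoreanField F

open Polynomial IsDedekindDomain
open scoped IntermediateField

/-! `E` is finite over some `K = k'(t)`, and it suffices to find a nonsquare sum of two squares in
`E₀(α)`, where `α ∉ E₀` is separable over `E₀`. Let `M` be the normal closure over `K` of `E(α,
√-1)`, `N` its separable part, and `H` the group of `N` over `E₀(α) ∩ N`. Some `z` in `N` is a
uniformizer at a place where all its other conjugates are units. Since `√-1 ∈ N`, the norm `s` of
`z` under `H` is a sum of two squares in `E₀(α) ∩ N`, and `s * τ s` has valuation one for `τ ∉ H`,
so is not a square in `N` (`exists_sq_add_sq_forall_not_isSquare_mul`).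

Suppose `y² = s` with `y ∈ E₀(α)`, and let `τ` move `α` over `E₀`. An automorphism over `N`
multiplies `y` and `τ y` by the same sign (`map_map_eq_smul_of_map_eq_smul`), so `y * τ y ∈ N` is a
square root of `s * τ s`, a contradiction. -/

/-! ### Places with trivial decomposition group -/

/-- A finite group acting on an integral extension `B` of `k[X]` has a maximal ideal with trivial
decomposition group. -/
theorem exists_isMaximal_forall_exists_smul_notMem {k B G : Type*} [Field k] [CommRing B]
    [IsDomain B] [Algebra k[X] B] [FaithfulSMul k[X] B] [Algebra.IsIntegral k[X] B] [Group G]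
    [Finite G] [MulSemiringAction G B] [SMulCommClass G k[X] B] [Algebra.IsInvariant k[X] B G]
    (β₀ : B) (hβ₀ : ∀ σ : G, σ ≠ 1 → σ • β₀ ≠ β₀) :
    ∃ P : Ideal B, P.IsMaximal ∧ P ≠ ⊥ ∧ ∀ σ : G, σ ≠ 1 → ∃ x ∈ P, σ • x ∉ P := by
  classical
  have := Fintype.ofFinite G
  have hinj : Function.Injective (algebraMap k[X] B) := FaithfulSMul.algebraMap_injective _ _
  obtain ⟨β, hβ0, hβ⟩ : ∃ β : B, β ≠ 0 ∧ ∀ σ : G, σ ≠ 1 → σ • β ≠ β := by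
    by_cases h : β₀ = 0
    · exact ⟨1, one_ne_zero, fun σ hσ => (hβ₀ σ hσ (by simp [h])).elim⟩
    · exact ⟨β₀, h, hβ₀⟩
  have hsmul : ∀ (σ : G) (a : k[X]), σ • algebraMap k[X] B a = algebraMap k[X] B a := fun σ a => by
    rw [Algebra.algebraMap_eq_smul_one, smul_comm, smul_one]
  obtain ⟨g, hg⟩ := (Polynomial.mem_lifts _).1 (Algebra.IsInvariant.charpoly_mem_lifts k[X] B G β)
  have hgeval : ∀ c : k[X],
      algebraMap k[X] B (g.eval c) = ∏ σ : G, (algebraMap k[X] B c - σ • β) := by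
    intro c
    rw [← Polynomial.eval₂_at_apply, ← Polynomial.eval_map, hg]
    simp [MulSemiringAction.charpoly, Polynomial.eval_prod]
  -- A discriminant: modulo a prime not containing `δ`, the conjugates of `β` stay distinct.
  set δ : B := ∏ p : {p : G × G // p.1 ≠ p.2}, (p.1.1 • β - p.1.2 • β) with hδ
  have hδ0 : δ ≠ 0 := by
    refine Finset.prod_ne_zero_iff.2 fun p _ h => hβ (p.1.1⁻¹ * p.1.2) ?_ ?_
    · exact fun h => p.2 (inv_mul_eq_one.1 h)
    · rw [mul_smul, ← sub_eq_zero.1 h, inv_smul_smul]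
  obtain ⟨d, hdmem, hd0⟩ := Submodule.exists_mem_ne_zero_of_ne_bot
    (Ideal.comap_ne_bot_of_integral_mem (R := k[X]) hδ0 (Ideal.mem_span_singleton_self δ)
      (Algebra.IsIntegral.isIntegral δ))
  have hdδ : δ ∣ algebraMap k[X] B d := Ideal.mem_span_singleton.1 hdmem
  set a := g.eval 0 with ha
  have ha0 : a ≠ 0 := by
    intro h
    have := hgeval 0
    rw [← ha, h, map_zero, eq_comm, Finset.prod_eq_zero_iff] at this
    obtain ⟨σ, -, h⟩ := this
    rw [zero_sub, neg_eq_zero, smul_eq_zero_iff_eq] at h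
    exact hβ0 h
  -- a value of `g` that is `a` times a nonunit congruent to `1` modulo `d`
  obtain ⟨h, c, hc, hnu, w, hw⟩ : ∃ h c : k[X], g.eval c = a * h ∧ ¬ IsUnit h ∧
      ∃ w, h = 1 + X * d * w := by
    have hgne : g - C a ≠ 0 := by
      intro h0
      have h1 := congrArg (eval β) hg
      rw [sub_eq_zero.1 h0, map_C, eval_C, MulSemiringAction.charpoly, eval_prod,
        Finset.prod_eq_zero (Finset.mem_univ 1) (by simp), map_eq_zero_iff _ hinj] at h1
      exact ha0 h1
    -- As in Euclid's argument, `c` divisible by `d * a` gives `g(c) = a * (1 + d * ⋯)`. The extra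
    -- `X` forces `h(0) = 1`, so a unit `h` would be `1`; varying `m` avoids this, also over finite
    -- `k`.
    obtain ⟨m, hm⟩ : ∃ m : ℕ, g.eval (X * d * a * X ^ m) ≠ a := by
      by_contra! hcon
      refine hgne (Polynomial.eq_zero_of_infinite_isRoot _ ?_)
      refine Set.infinite_of_injective_forall_mem (f := fun m : ℕ => X * d * a * X ^ m) ?_ ?_
      · intro m n hmn
        have h2 : (X : k[X]) ^ m = X ^ n :=
          mul_left_cancel₀ (mul_ne_zero (mul_ne_zero X_ne_zero hd0) ha0) hmn
        simpa using congrArg natDegree h2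
      · intro m
        simp [hcon m]
    obtain ⟨r, hr⟩ := Polynomial.sub_dvd_eval_sub (X * d * a * X ^ m) 0 g
    refine ⟨1 + X * d * (X ^ m * r), X * d * a * X ^ m, ?_, ?_, _, rfl⟩
    · rw [← ha, sub_zero] at hr
      linear_combination hr
    · intro hu
      obtain ⟨u, hu, hu'⟩ := Polynomial.isUnit_iff.1 hu
      have h3 := congrArg (eval 0) hu'
      simp at h3
      apply hm
      rw [h3, C_1] at hu'
      rw [← ha, sub_zero] at hr
      linear_combination hr - a * hu'
  obtain ⟨m, hmmax, hm⟩ := Ideal.exists_le_maximal (Ideal.span {h}) (by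
    rwa [Ne, Ideal.span_singleton_eq_top])
  have hhm : h ∈ m := hm (Ideal.mem_span_singleton_self h)
  obtain ⟨P, hP, hPm⟩ := Ideal.exists_ideal_over_maximal_of_isIntegral (S := B) m (by
    rw [(RingHom.injective_iff_ker_eq_bot _).1 hinj]; exact bot_le)
  have hmP : ∀ x : k[X], algebraMap k[X] B x ∈ P ↔ x ∈ m := fun x => by rw [← hPm, Ideal.mem_comap]
  have hdm : d ∉ m := fun hd => hmmax.ne_top ((Ideal.eq_top_iff_one m).2 (by
    have : (1 : k[X]) = h - (X * w) * d := by rw [hw]; ring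
    rw [this]
    exact m.sub_mem hhm (m.mul_mem_left _ hd)))
  have hδP : δ ∉ P := fun h' => hdm ((hmP d).1 (P.mem_of_dvd hdδ h'))
  have hprod : ∏ σ : G, (algebraMap k[X] B c - σ • β) ∈ P := by
    rw [← hgeval, hmP, hc]
    exact m.mul_mem_left _ hhm
  -- `c` is congruent to exactly one conjugate `τ • β` modulo `P`, so `σ ≠ 1` sends `c - τ • β` out
  -- of `P`.
  obtain ⟨τ, -, hτ⟩ := hP.isPrime.prod_mem_iff.1 hprod
  refine ⟨P, hP, ?_, fun σ hσ => ⟨_, hτ, fun hcon => hδP ?_⟩⟩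
  · rintro rfl
    have : m = ⊥ := by
      rw [← hPm, Ideal.comap_bot_of_injective _ hinj]
    subst this
    exact Polynomial.not_isField k (Ring.isField_iff_maximal_bot.2 hmmax)
  · rw [smul_sub, hsmul] at hcon
    have h4 : τ • β - (σ * τ) • β ∈ P := by
      rw [mul_smul]
      have := P.sub_mem hcon hτ
      simpa using this
    refine P.mem_of_dvd (Finset.dvd_prod_of_mem _ (Finset.mem_univ
      (⟨(τ, σ * τ), fun h => hσ (by simpa using h.symm)⟩ : {p : G × G // p.1 ≠ p.2}))) h4

/-- A maximal ideal with trivial decomposition group carries an element that is a uniformizer at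
it and a unit at all of its other conjugates. -/
theorem exists_mem_notMem_sq_forall_smul_notMem {B G : Type*} [CommRing B] [IsDedekindDomain B]
    [Group G] [Finite G] [MulSemiringAction G B] (P : Ideal B) (hP : P.IsMaximal) (hP0 : P ≠ ⊥)
    (hdec : ∀ σ : G, σ ≠ 1 → ∃ x ∈ P, σ • x ∉ P) :
    ∃ z ∈ P, z ∉ P ^ 2 ∧ ∀ σ : G, σ ≠ 1 → σ • z ∉ P := by
  classical
  have := Fintype.ofFinite G
  obtain ⟨ϖ, hϖ, hϖ'⟩ := Ideal.exists_mem_pow_notMem_pow_succ P hP0 hP.ne_top 1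
  rw [pow_one] at hϖ
  let Q : G → Ideal B := fun σ => P.comap (MulSemiringAction.toRingHom G B σ)
  have hmem : ∀ σ x, x ∈ Q σ ↔ σ • x ∈ P := fun σ x => Iff.rfl
  have hQp : ∀ σ, (Q σ).IsPrime := fun σ => hP.isPrime.comap _
  have hQ0 : ∀ σ, Q σ ≠ ⊥ := by
    intro σ h
    refine hP0 (eq_bot_iff.2 fun x hx => ?_)
    have : σ⁻¹ • x ∈ Q σ := by rwa [hmem, smul_inv_smul]
    rw [h, Ideal.mem_bot, smul_eq_zero_iff_eq] at this
    exact this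
  have hQinj : Function.Injective Q := by
    intro σ τ h
    by_contra hne
    obtain ⟨x, hx, hx'⟩ := hdec (σ * τ⁻¹) fun h => hne (mul_inv_eq_one.1 h)
    have h1 : τ⁻¹ • x ∈ Q τ := by rwa [hmem, smul_inv_smul]
    rw [← h, hmem, ← mul_smul] at h1
    exact hx' h1
  -- The conjugates `Q σ = σ⁻¹ P` are distinct, so the Chinese remainder theorem applies.
  obtain ⟨z, hz⟩ := IsDedekindDomain.exists_forall_sub_mem_ideal (s := Finset.univ) Q
    (fun _ => 2) (fun σ _ => Ideal.prime_of_isPrime (hQ0 σ) (hQp σ))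
    (fun σ _ τ _ h => hQinj.ne h) (fun σ => if σ.1 = 1 then ϖ else 1)
  have hQ1 : Q 1 = P := by ext x; rw [hmem, one_smul]
  have hz1 : z - ϖ ∈ P ^ 2 := by simpa [hQ1] using hz 1 (Finset.mem_univ _)
  refine ⟨z, ?_, ?_, ?_⟩
  · simpa using P.add_mem (Ideal.pow_le_self two_ne_zero hz1) hϖ
  · intro h
    exact hϖ' (by simpa using (P ^ 2).sub_mem h hz1)
  · intro σ hσ h
    have h1 : z - 1 ∈ Q σ := by
      simpa [hσ] using Ideal.pow_le_self two_ne_zero (hz σ (Finset.mem_univ _))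
    exact (hQp σ).ne_top ((Ideal.eq_top_iff_one _).2 (by
      simpa using (Q σ).sub_mem ((hmem σ z).2 h) h1))

/-- A finite Galois extension of a rational function field in one variable has a discrete
valuation and a uniformizer all of whose nontrivial conjugates are units. -/
theorem exists_valuation_eq_exp_neg_one_forall_eq_one (k K N : Type*) [Field k] [Field K] [Field N]
    [Algebra k[X] K] [IsFractionRing k[X] K] [Algebra K N] [FiniteDimensional K N] [IsGalois K N] :
    ∃ (v : Valuation N (WithZero (Multiplicative ℤ))) (z : N), v z = WithZero.exp (-1) ∧
      ∀ σ : Gal(N/K), σ ≠ 1 → v (σ z) = 1 := by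
  let _ : Algebra k[X] N := ((algebraMap K N).comp (algebraMap k[X] K)).toAlgebra
  have : IsScalarTower k[X] K N := IsScalarTower.of_algebraMap_eq fun _ => rfl
  let B := integralClosure k[X] N
  have : IsDedekindDomain B := integralClosure.isDedekindDomain k[X] K N
  have : IsFractionRing B N := integralClosure.isFractionRing_of_finite_extension K N
  let _ : MulSemiringAction Gal(N/K) B := IsIntegralClosure.MulSemiringAction k[X] K N B
  have : Algebra.IsInvariant k[X] B Gal(N/K) := Algebra.isInvariant_of_isGalois k[X] K N B
  have hact : ∀ (σ : Gal(N/K)) (x : B), ((σ • x : B) : N) = σ x := fun σ x =>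
    algebraMap_galRestrict_apply k[X] σ x
  have : SMulCommClass Gal(N/K) k[X] B := ⟨fun σ a x => by
    exact map_smul (galRestrict k[X] K N B σ) a x⟩
  have : FaithfulSMul k[X] N := (faithfulSMul_iff_algebraMap_injective _ _).2
    ((algebraMap K N).injective.comp (IsFractionRing.injective k[X] K))
  have : FaithfulSMul k[X] B := (faithfulSMul_iff_algebraMap_injective _ _).2 fun x y h =>
    FaithfulSMul.algebraMap_injective k[X] N (congrArg (algebraMap B N) h)
  obtain ⟨β, hβ⟩ := Field.exists_primitive_element K N
  obtain ⟨y, hy0, hy⟩ := exists_integral_multiples k[X] K ({β} : Finset N)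
  have hyβ := hy β (Finset.mem_singleton_self β)
  obtain ⟨P, hP, hP0, hdec⟩ := exists_isMaximal_forall_exists_smul_notMem (G := Gal(N/K))
    (k := k) (⟨y • β, hyβ⟩ : B) fun σ hσ h => hσ <| by
      have h1 := congrArg (algebraMap B N) h
      change ((σ • (⟨y • β, hyβ⟩ : B) : B) : N) = y • β at h1
      rw [hact] at h1
      change σ (y • β) = y • β at h1
      rw [algebra_compatible_smul K, map_smul] at h1
      have h2 : σ β = β := smul_right_injective N
        ((map_ne_zero_iff _ (IsFractionRing.injective k[X] K)).2 hy0) h1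
      ext x
      obtain ⟨r, s, rfl⟩ := (IntermediateField.mem_adjoin_simple_iff K x).1
        (hβ ▸ IntermediateField.mem_top)
      rw [map_div₀, ← aeval_algHom_apply, ← aeval_algHom_apply, h2, AlgEquiv.one_apply]
  obtain ⟨z, hzP, hzP2, hz⟩ := exists_mem_notMem_sq_forall_smul_notMem P hP hP0 hdec
  let v : HeightOneSpectrum B := ⟨P, hP.isPrime, hP0⟩
  refine ⟨v.valuation N, z, ?_, fun σ hσ => ?_⟩
  · change v.valuation N (algebraMap B N z) = _
    rw [HeightOneSpectrum.valuation_of_algebraMap]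
    have h1 := (v.intValuation_le_pow_iff_mem z 1).2 (by rwa [pow_one])
    have h2 := (v.intValuation_le_pow_iff_mem z 2).not.2 hzP2
    have h0 : v.intValuation z ≠ 0 := fun h => h2 (h ▸ zero_le)
    refine le_antisymm h1 ((WithZero.le_log_iff_exp_le h0).1 ?_)
    have h3 := (WithZero.log_le_iff_le_exp h0).not.2 h2
    push_cast at h3
    lia
  · rw [← hact]
    refine le_antisymm (v.valuation_le_one _) (not_lt.1 fun h => hz σ hσ ?_)
    exact (v.valuation_lt_one_iff_mem _).1 h

/-! ### Norms as sums of two squares -/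

/-- In the presence of a square root of `-1`, norms under a finite group of automorphisms are sums
of two squares of invariants. -/
theorem exists_sq_add_sq_eq_prod_smul {N H : Type*} [Field N] [Group H] [Fintype H]
    [MulSemiringAction H N] (h2 : (2 : N) ≠ 0) (j : N) (hj : j ^ 2 = -1) (z : N) :
    ∃ a b : N, (∀ h : H, h • a = a) ∧ (∀ h : H, h • b = b) ∧ ∏ h : H, h • z = a ^ 2 + b ^ 2 := by
  classical
  have hj0 : j ≠ 0 := by rintro rfl; simp at hj
  have hjj : ∀ h : H, h • j = j ∨ h • j = -j := fun h => by
    rw [← sq_eq_sq_iff_eq_or_eq_neg, ← smul_pow', hj, smul_neg, smul_one]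
  have hjne : -j ≠ j := fun h => by
    have : 2 * j = 0 := by linear_combination -h
    simp_all
  -- The norm is `u * w`. Automorphisms fixing `j` fix `u` and `w`; those negating `j` swap them.
  -- Hence `(u + w) / 2` and `(u - w) / (2 * j)` are invariant, and their squares add up to `u * w`.
  set u := ∏ h : H with h • j = j, h • z
  set w := ∏ h : H with ¬ h • j = j, h • z
  have hsmul : ∀ (g : H) (p : H → Prop) [DecidablePred p],
      g • ∏ h : H with p h, h • z = ∏ h : H with p (g⁻¹ * h), h • z := by
    intro g p _
    rw [Finset.smul_prod']
    refine Finset.prod_bij' (fun h _ => g * h) (fun h _ => g⁻¹ * h) ?_ ?_ ?_ ?_ ?_ <;>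
      simp [mul_smul]
  have key : ∀ g : H, (g • j = j ∧ g • u = u ∧ g • w = w) ∨
      (g • j = -j ∧ g • u = w ∧ g • w = u) := by
    intro g
    have hinv : ∀ h : H, (g⁻¹ * h) • j = j ↔ h • j = g • j := fun h => by
      rw [mul_smul, inv_smul_eq_iff]
    refine (hjj g).imp (fun hg => ⟨hg, ?_, ?_⟩) (fun hg => ⟨hg, ?_, ?_⟩) <;>
      rw [hsmul] <;> refine Finset.prod_congr (Finset.filter_congr fun h _ => ?_) fun _ _ => rfl <;>
      rw [hinv, hg]
    · rcases hjj h with h' | h' <;> simp [h', hjne, hjne.symm]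
    · rcases hjj h with h' | h' <;> simp [h', hjne, hjne.symm]
  have hs2 : ∀ g : H, g • (2 : N) = 2 := fun g => map_ofNat (MulSemiringAction.toRingHom H N g) 2
  refine ⟨(u + w) / 2, (u - w) / (2 * j), fun g => ?_, fun g => ?_, ?_⟩
  · rcases key g with ⟨h, hu, hw⟩ | ⟨h, hu, hw⟩ <;> rw [smul_div₀', smul_add, hs2, hu, hw]
    rw [add_comm]
  · rcases key g with ⟨h, hu, hw⟩ | ⟨h, hu, hw⟩ <;>
      rw [smul_div₀', smul_sub, smul_mul', hs2, hu, hw, h]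
    rw [div_eq_div_iff (by simp [*]) (by simp [*])]
    ring
  · rw [← Finset.prod_filter_mul_prod_filter_not _ (fun h : H => h • j = j)]
    change u * w = _
    rw [div_pow, div_pow, mul_pow, hj]
    field_simp
    ring

/-- In a finite Galois extension of a rational function field, every subgroup of the Galois group
fixes a sum of two squares `s` such that `s * τ s` is a nonsquare for all `τ` outside of it. -/
theorem exists_sq_add_sq_forall_not_isSquare_mul (k : Type*) {K N : Type*} [Field k] [Field K]
    [Field N] [Algebra k[X] K] [IsFractionRing k[X] K] [Algebra K N] [FiniteDimensional K N]
    [IsGalois K N] (h2 : (2 : N) ≠ 0) (j : N) (hj : j ^ 2 = -1) (H : Subgroup Gal(N/K)) :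
    ∃ a b : N, (∀ h ∈ H, h a = a) ∧ (∀ h ∈ H, h b = b) ∧
      ∀ τ ∉ H, ¬ IsSquare ((a ^ 2 + b ^ 2) * τ (a ^ 2 + b ^ 2)) := by
  classical
  have := Fintype.ofFinite H
  obtain ⟨v, z, hz, hzσ⟩ := exists_valuation_eq_exp_neg_one_forall_eq_one k K N
  obtain ⟨a, b, ha, hb, hs⟩ := exists_sq_add_sq_eq_prod_smul (H := H) h2 j hj z
  refine ⟨a, b, fun h hh => ha ⟨h, hh⟩, fun h hh => hb ⟨h, hh⟩, fun τ hτ ⟨w, hw⟩ => ?_⟩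
  have h1 : v (∏ h : H, h • z) = WithZero.exp (-1) := by
    rw [map_prod, Finset.prod_eq_single 1 (fun h _ hh => ?_) (by simp), one_smul, hz]
    exact hzσ h (by simpa using hh)
  -- No `τ * h` is trivial because `τ ∉ H`, so only unit conjugates of `z` occur.
  have h3 : v (τ (∏ h : H, h • z)) = 1 := by
    rw [map_prod, map_prod]
    refine Finset.prod_eq_one fun h _ => hzσ (τ * h) fun h' => hτ ?_
    rw [mul_eq_one_iff_eq_inv.1 h']
    exact H.inv_mem h.2
  have h4 := congrArg v hw
  rw [← hs, map_mul, h1, h3, mul_one, map_mul] at h4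
  have h0 : v w ≠ 0 := by
    intro h
    simp [h] at h4
  have h5 := congrArg WithZero.log h4
  rw [WithZero.log_exp, WithZero.log_mul h0 h0] at h5
  lia

/-! ### Descent from the infinite extension to a finite Galois one -/

theorem isSeparable_of_sq_eq_algebraMap {K L : Type*} [Field K] [Field L] [Algebra K L]
    (h2 : (2 : K) ≠ 0) {x : L} {a : K} (hx : x ^ 2 = algebraMap K L a) : IsSeparable K x := by
  by_cases ha : a = 0
  · have : x = algebraMap K L 0 := by simpa [ha] using hx
    rw [this]
    exact isSeparable_algebraMap 0
  · refine Polynomial.Separable.of_dvd (separable_X_pow_sub_C a (n := 2) (by exact_mod_cast h2) ha)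
      (minpoly.dvd K x ?_)
    simp [hx]

/-- If a semilinear automorphism fixes `α` and its conjugate `τ α`, then its action on
`y ∈ E₀(α)` by a scalar is carried over to `τ y`. -/
theorem map_map_eq_smul_of_map_eq_smul {E₀ Ω : Type*} [Field E₀] [Field Ω] [Algebra E₀ Ω] {α : Ω}
    (hα : IsIntegral E₀ α) (ρ : Ω →+* Ω) (ρ₀ : E₀ →+* E₀)
    (hρ : ∀ c, ρ (algebraMap E₀ Ω c) = algebraMap E₀ Ω (ρ₀ c)) (τ : Ω →ₐ[E₀] Ω)
    (h1 : ρ α = α) (h2 : ρ (τ α) = τ α) {y : Ω} (hy : y ∈ E₀⟮α⟯) {ε : E₀} (h : ρ y = ε • y) :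
    ρ (τ y) = ε • τ y := by
  have haeval : ∀ (β : Ω) (p : E₀[X]), ρ (aeval β p) = aeval (ρ β) (p.map ρ₀) := by
    intro β p
    rw [aeval_def, hom_eval₂, aeval_def, eval₂_map]
    congr 1
    ext c
    exact hρ c
  have hy' : y ∈ E₀⟮α⟯.toSubalgebra := hy
  rw [IntermediateField.adjoin_simple_toSubalgebra_of_isAlgebraic hα.isAlgebraic,
    Algebra.adjoin_singleton_eq_range_aeval] at hy'
  obtain ⟨p₀, hp₀⟩ := hy'
  -- Below the degree of the minimal polynomial, the value at `α` determines `p`; thus `ρ y = ε • y`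
  -- lifts to `p.map ρ₀ = C ε * p`, which can be evaluated at `τ α`.
  obtain ⟨p, hpdeg, rfl⟩ : ∃ p : E₀[X], p.degree < (minpoly E₀ α).degree ∧ aeval α p = y := by
    refine ⟨p₀ %ₘ minpoly E₀ α, degree_modByMonic_lt _ (minpoly.monic hα), ?_⟩
    have := congrArg (aeval α) (modByMonic_add_div p₀ (minpoly E₀ α))
    rw [map_add, map_mul, minpoly.aeval, zero_mul, add_zero] at this
    rw [this]
    exact hp₀
  have hp : p.map ρ₀ - C ε * p = 0 := by
    by_contra hne
    refine (minpoly.degree_le_of_ne_zero E₀ α hne ?_).not_gt ?_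
    · rw [haeval, h1, ← sub_eq_zero] at h
      rw [map_sub, map_mul, aeval_C, ← Algebra.smul_def, h]
    · refine (degree_sub_le _ _).trans_lt (max_lt (degree_map_le.trans_lt hpdeg) ?_)
      rw [← smul_eq_C_mul]
      exact (degree_smul_le _ _).trans_lt hpdeg
  rw [← aeval_algHom_apply, haeval, h2, sub_eq_zero.1 hp, map_mul, aeval_C, Algebra.smul_def]

/-- A proper separable simple extension of a normal extension of a finite extension of a rational
function field contains a sum of two squares that is not a square. -/
theorem exists_sq_add_sq_mem_adjoin_forall_sq_ne (k : Type*) {K E E₀ Ω : Type*} [Field k] [Field K]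
    [Field E] [Field E₀] [Field Ω] [Algebra k[X] K] [IsFractionRing k[X] K] [Algebra K E]
    [Algebra K E₀] [Algebra K Ω] [Algebra E E₀] [Algebra E Ω] [Algebra E₀ Ω] [IsScalarTower K E Ω]
    [IsScalarTower K E₀ Ω] [IsScalarTower E E₀ Ω] [FiniteDimensional K E] [Normal E E₀]
    [IsAlgClosure K Ω] (h2 : (2 : K) ≠ 0) {α : Ω} (hα : IsSeparable E₀ α)
    (hα0 : α ∉ (⊥ : IntermediateField E₀ Ω)) :
    ∃ a ∈ E₀⟮α⟯, ∃ b ∈ E₀⟮α⟯, ∀ y ∈ E₀⟮α⟯, y ^ 2 ≠ a ^ 2 + b ^ 2 := by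
  have : IsAlgClosed Ω := IsAlgClosure.isAlgClosed K
  have : Algebra.IsAlgebraic K Ω := IsAlgClosure.isAlgebraic
  have : Algebra.IsAlgebraic E₀ Ω := Algebra.IsAlgebraic.tower_top (K := K) E₀
  have : Normal K Ω := IsAlgClosure.normal K Ω
  have : IsAlgClosure E₀ Ω := ⟨inferInstance, inferInstance⟩
  have : Normal E₀ Ω := IsAlgClosure.normal E₀ Ω
  have h2Ω : (2 : Ω) ≠ 0 := by
    rw [← map_ofNat (algebraMap K Ω) 2]
    exact (_root_.map_ne_zero _).2 h2
  obtain ⟨j, hj⟩ := IsAlgClosed.exists_pow_nat_eq (-1 : Ω) two_pos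
  let D : IntermediateField K Ω := (IsScalarTower.toAlgHom K E Ω).fieldRange ⊔ K⟮α⟯ ⊔ K⟮j⟯
  have : FiniteDimensional K (IsScalarTower.toAlgHom K E Ω).fieldRange :=
    (AlgEquiv.ofInjectiveField (IsScalarTower.toAlgHom K E Ω)).toLinearEquiv.finiteDimensional
  have : FiniteDimensional K K⟮α⟯ :=
    IntermediateField.adjoin.finiteDimensional (Algebra.IsIntegral.isIntegral α)
  have : FiniteDimensional K K⟮j⟯ :=
    IntermediateField.adjoin.finiteDimensional (Algebra.IsIntegral.isIntegral j)
  let M := IntermediateField.normalClosure K D Ω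
  have hDM : D ≤ M := D.le_normalClosure
  have hEM : ∀ x : E, algebraMap E Ω x ∈ M := fun x =>
    hDM ((le_sup_left.trans le_sup_left : (IsScalarTower.toAlgHom K E Ω).fieldRange ≤ D) ⟨x, rfl⟩)
  have hαM : α ∈ M := hDM ((le_sup_right.trans le_sup_left : K⟮α⟯ ≤ D)
    (IntermediateField.mem_adjoin_simple_self K α))
  have hjM : j ∈ M := hDM ((le_sup_right : K⟮j⟯ ≤ D) (IntermediateField.mem_adjoin_simple_self K j))
  -- `E / K` may be inseparable, so `M / K` need not be Galois. Its separable part is, and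
  -- automorphisms over it still fix all of `M`.
  let N := M ⊓ separableClosure K Ω
  have : FiniteDimensional K N :=
    FiniteDimensional.of_injective (IntermediateField.inclusion (inf_le_left : N ≤ M)).toLinearMap
      (IntermediateField.inclusion (inf_le_left : N ≤ M)).injective
  have : Algebra.IsSeparable K N :=
    Algebra.IsSeparable.of_algHom K (separableClosure K Ω)
      (IntermediateField.inclusion inf_le_right)
  have : IsGalois K (separableClosure K Ω) := inferInstance
  have : Normal K N := inferInstance
  have : IsGalois K N := ⟨⟩
  -- `M` is purely inseparable over `N`
  let q := ringExpChar K
  have : ExpChar K q := inferInstance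
  have : ExpChar Ω q := expChar_of_injective_algebraMap (algebraMap K Ω).injective q
  have : ExpChar (separableClosure K Ω) q :=
    expChar_of_injective_algebraMap (algebraMap K (separableClosure K Ω)).injective q
  have hpow : ∀ x ∈ M, ∃ n, x ^ q ^ n ∈ N := fun x hx => by
    obtain ⟨n, ⟨y, hy⟩⟩ := IsPurelyInseparable.pow_mem (separableClosure K Ω) q x
    exact ⟨n, pow_mem hx _, hy ▸ y.2⟩
  have hfix : ∀ (σ : Ω ≃ₐ[K] Ω) (x : Ω) (n : ℕ), σ (x ^ q ^ n) = x ^ q ^ n → σ x = x := by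
    intro σ x n h
    rw [map_pow] at h
    exact iterateFrobenius_inj Ω q n h
  have hNM : ∀ ρ : Ω ≃ₐ[N] Ω, ∀ x ∈ M, ρ x = x := fun ρ x hx => by
    obtain ⟨n, hn⟩ := hpow x hx
    exact hfix (ρ.restrictScalars K) x n (ρ.commutes ⟨_, hn⟩)
  have hjN : j ∈ N := ⟨hjM, mem_separableClosure_iff.2
    (isSeparable_of_sq_eq_algebraMap h2 (a := -1) (by simpa using hj))⟩
  have h2N : (2 : N) ≠ 0 := fun h => h2Ω (congrArg (algebraMap N Ω) h)
  let F : IntermediateField K N := (E₀⟮α⟯.restrictScalars K).comap N.val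
  have hF : ∀ x : N, x ∈ F ↔ (x : Ω) ∈ E₀⟮α⟯ := fun x => Iff.rfl
  obtain ⟨a, b, ha, hb, hab⟩ := exists_sq_add_sq_forall_not_isSquare_mul k h2N (⟨j, hjN⟩ : N)
    (Subtype.ext hj) F.fixingSubgroup
  have hmemF : ∀ x : N, (∀ h ∈ F.fixingSubgroup, h x = x) → (x : Ω) ∈ E₀⟮α⟯ := by
    intro x hx
    rw [← hF, ← IsGalois.fixedField_fixingSubgroup F]
    exact fun h => hx h h.2
  refine ⟨a, hmemF a ha, b, hmemF b hb, fun y hy hyab => ?_⟩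
  obtain ⟨α', hne, hconj⟩ := (notMem_iff_exists_ne_and_isConjRoot hα
    (IsAlgClosed.splits _)).1 hα0
  obtain ⟨τ, hτ⟩ := isConjRoot_iff_exists_algEquiv.1 hconj.symm
  let τK : Ω ≃ₐ[K] Ω := τ.restrictScalars K
  have hτN : ∀ x : N, ((τK.restrictNormal N x : N) : Ω) = τ x := fun x =>
    τK.restrictNormal_commutes N x
  have hταM : τ α ∈ M := by
    have := τK.restrictNormal_commutes M ⟨α, hαM⟩
    change _ = τ α at this
    rw [← this]
    exact (τK.restrictNormal M ⟨α, hαM⟩).2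
  -- `α` itself may lie outside `N`, but some `α ^ q ^ n` lies in `F`, and fixing it would force `τ`
  -- to fix `α`.
  have hτH : τK.restrictNormal N ∉ F.fixingSubgroup := by
    intro h
    obtain ⟨n, hn⟩ := hpow α hαM
    have h1 := (F.mem_fixingSubgroup_iff _).1 h ⟨_, hn⟩
      ((hF _).2 (pow_mem (IntermediateField.mem_adjoin_simple_self E₀ α) _))
    have h3 := hfix τK α n ((hτN _).symm.trans (congrArg (algebraMap N Ω) h1))
    exact hne (hτ.symm.trans h3).symm
  set s : N := a ^ 2 + b ^ 2 with hs
  have hsy : y ^ 2 = s := hyab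
  have hw : ∀ ρ : Ω ≃ₐ[N] Ω, ρ (y * τ y) = y * τ y := by
    intro ρ
    -- `ρ` fixes `M`, hence `E`, `α` and `τ α`; as `E₀ / E` is normal, it acts on `E₀`, as the
    -- semilinear lemma requires.
    let ρE : Ω ≃ₐ[E] Ω := AlgEquiv.ofRingEquiv (f := ρ.toRingEquiv) fun x => hNM ρ _ (hEM x)
    have hρy : ∃ ε : E₀, ε * ε = 1 ∧ ρ y = ε • y := by
      have : (ρ y) ^ 2 = y ^ 2 := by
        rw [← map_pow, hsy]
        exact ρ.commutes s
      rcases sq_eq_sq_iff_eq_or_eq_neg.1 this with h | h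
      · exact ⟨1, by simp, by simp [h]⟩
      · exact ⟨-1, by simp, by simp [h]⟩
    obtain ⟨ε, hε, hρy⟩ := hρy
    have := map_map_eq_smul_of_map_eq_smul (hα.isIntegral) (ρ : Ω →+* Ω)
      (ρE.restrictNormal E₀ : E₀ →+* E₀) (fun c => (ρE.restrictNormal_commutes E₀ c).symm)
      (τ : Ω →ₐ[E₀] Ω) (hNM ρ _ hαM) (hNM ρ _ hταM) hy hρy
    change ρ (τ y) = ε • τ y at this
    rw [map_mul, hρy, this, smul_mul_smul_comm, hε, one_smul]
  have hwsq : (y * τ y) ^ 2 = algebraMap N Ω (s * τK.restrictNormal N s) := by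
    rw [mul_pow, ← map_pow, hsy, map_mul]
    exact congrArg _ (hτN s).symm
  have : Normal N Ω := inferInstance
  -- With its square in `N` and `2 ≠ 0`, the element is separable over `N`, so being fixed by all
  -- automorphisms puts it in `N`.
  have hwN : y * τ y ∈ (⊥ : IntermediateField N Ω) := by
    by_contra hcon
    obtain ⟨w', hne', hconj'⟩ := (notMem_iff_exists_ne_and_isConjRoot
      (isSeparable_of_sq_eq_algebraMap h2N hwsq) (IsAlgClosed.splits _)).1 hcon
    obtain ⟨ρ, hρ⟩ := isConjRoot_iff_exists_algEquiv.1 hconj'.symm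
    exact hne' ((hw ρ).symm.trans hρ)
  obtain ⟨w, hw'⟩ := hwN
  refine hab _ hτH ⟨w, (algebraMap N Ω).injective ?_⟩
  rw [← hwsq, ← hw', map_mul, sq]
  rfl

/-! ### Reduction to a rational function field -/

/-- Take a maximal set `T` of generators over which `E` is not algebraic. One more generator `t`
makes `E` algebraic, hence finite, and `t` is transcendental over `k(T)`, as otherwise `E` would be
algebraic over it. -/
theorem exists_transcendental_finiteDimensional_adjoin {k E : Type*} [Field k] [Field E]
    [Algebra k E] (hfg : (⊤ : IntermediateField k E).FG) (h : ¬ Algebra.IsAlgebraic k E) :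
    ∃ (k' : IntermediateField k E) (t : E), Transcendental k' t ∧ FiniteDimensional k'⟮t⟯ E := by
  classical
  obtain ⟨S, hS⟩ := hfg
  obtain ⟨T, hT⟩ := (S.powerset.filter fun T : Finset E =>
    ¬ Algebra.IsAlgebraic (IntermediateField.adjoin k (T : Set E)) E).exists_maximal
    ⟨∅, by
      simp only [Finset.mem_filter, Finset.empty_mem_powerset, true_and]
      intro hcon
      rw [Finset.coe_empty, IntermediateField.adjoin_empty] at hcon
      exact h (Algebra.IsAlgebraic.trans k (⊥ : IntermediateField k E) E)⟩
  obtain ⟨hTS, hTalg⟩ := Finset.mem_filter.1 hT.1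
  rw [Finset.mem_powerset] at hTS
  obtain ⟨t, htS, htT⟩ : ∃ t ∈ S, t ∉ T := by
    by_contra! hcon
    rw [hTS.antisymm hcon, hS] at hTalg
    exact hTalg ⟨fun x => isAlgebraic_algebraMap (⟨x, trivial⟩ : (⊤ : IntermediateField k E))⟩
  let k' := IntermediateField.adjoin k (T : Set E)
  have halg : Algebra.IsAlgebraic k'⟮t⟯ E := by
    by_contra hcon
    refine htT (hT.2 (y := insert t T) (Finset.mem_filter.2 ⟨?_, fun hcon' => hcon ?_⟩)
      (Finset.subset_insert t T) (Finset.mem_insert_self t T))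
    · exact Finset.mem_powerset.2 (Finset.insert_subset htS hTS)
    · rw [Finset.coe_insert, ← Set.union_singleton, ← IntermediateField.adjoin_adjoin_left] at hcon'
      exact hcon'
  refine ⟨k', t, fun ht => hTalg ?_, ?_⟩
  · have := IntermediateField.isAlgebraic_adjoin_simple ht.isIntegral
    exact Algebra.IsAlgebraic.trans k' k'⟮t⟯ E
  · have htop := IntermediateField.adjoin_eq_top_of_adjoin_eq_top k'
      (E := k'⟮t⟯) (IntermediateField.adjoin_eq_top_of_adjoin_eq_top k (E := k') hS)
    have : FiniteDimensional k'⟮t⟯ (IntermediateField.adjoin k'⟮t⟯ (S : Set E)) :=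
      IntermediateField.finiteDimensional_adjoin fun x _ => Algebra.IsIntegral.isIntegral x
    rw [htop] at this
    exact (IntermediateField.topEquiv (F := k'⟮t⟯) (E := E)).toLinearEquiv.finiteDimensional

theorem exists_isFractionRing_polynomial_adjoin {k E : Type*} [Field k] [Field E] [Algebra k E]
    {t : E} (ht : Transcendental k t) : ∃ _ : Algebra k[X] k⟮t⟯, IsFractionRing k[X] k⟮t⟯ := by
  let _ : Algebra k[X] k⟮t⟯ :=
    (aeval (IntermediateField.AdjoinSimple.gen k t)).toRingHom.toAlgebra
  have hmap : ∀ p : k[X], ((algebraMap k[X] k⟮t⟯ p : k⟮t⟯) : E) = aeval t p := fun p =>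
    (aeval_algHom_apply k⟮t⟯.val (IntermediateField.AdjoinSimple.gen k t) p).symm
  have : FaithfulSMul k[X] k⟮t⟯ := (faithfulSMul_iff_algebraMap_injective _ _).2 fun p r h =>
    transcendental_iff_injective.1 ht ((hmap p).symm.trans ((congrArg k⟮t⟯.val h).trans (hmap r)))
  refine ⟨inferInstance, IsFractionRing.of_field _ _ fun z => ?_⟩
  obtain ⟨r, s, h⟩ := (IntermediateField.mem_adjoin_simple_iff k (z : E)).1 z.2
  refine ⟨r, s, Subtype.ext ?_⟩
  rw [h, ← hmap, ← hmap]
  rfl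

/-- A finite, not purely inseparable extension of a normal extension of a finite extension of a
rational function field is not pythagorean. -/
theorem not_isPythagoreanField_of_normal_of_finiteDimensional (k : Type*) {K E E₀ F : Type*}
    [Field k] [Field K] [Field E] [Field E₀] [Field F] [Algebra k[X] K] [IsFractionRing k[X] K]
    [Algebra K E] [Algebra K E₀] [Algebra K F] [Algebra E E₀] [Algebra E F] [Algebra E₀ F]
    [IsScalarTower K E E₀] [IsScalarTower K E F] [IsScalarTower K E₀ F] [IsScalarTower E E₀ F]
    [FiniteDimensional K E] [Normal E E₀] [FiniteDimensional E₀ F] (h2 : (2 : K) ≠ 0)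
    (hins : ¬ IsPurelyInseparable E₀ F) : ¬ IsPythagoreanField F := by
  intro hpyth
  let Ω := AlgebraicClosure F
  have : Algebra.IsAlgebraic K E₀ := Algebra.IsAlgebraic.trans K E E₀
  have : Algebra.IsAlgebraic K F := Algebra.IsAlgebraic.trans K E₀ F
  have : Algebra.IsAlgebraic K Ω := Algebra.IsAlgebraic.trans K F Ω
  have : IsAlgClosure K Ω := ⟨inferInstance, inferInstance⟩
  -- `L` is simple over `E₀`, and proper since `F` is not purely inseparable. Any square root in `F`
  -- of an element of `L` is separable, hence in `L`, so a nonsquare of `L` stays one in `F`.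
  let L := separableClosure E₀ F
  obtain ⟨β, hβ⟩ := Field.exists_primitive_element E₀ L
  let φ : L →ₐ[E₀] Ω := IsScalarTower.toAlgHom E₀ L Ω
  have hrange : E₀⟮φ β⟯ = φ.fieldRange := by
    rw [AlgHom.fieldRange_eq_map, ← hβ, IntermediateField.adjoin_map, Set.image_singleton]
  have hβ0 : φ β ∉ (⊥ : IntermediateField E₀ Ω) := by
    rintro ⟨c, hc⟩
    have hc' : algebraMap E₀ L c = β := φ.injective ((φ.commutes c).trans hc)
    have hbot : (⊤ : IntermediateField E₀ L) = ⊥ := by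
      rw [← hβ, IntermediateField.adjoin_simple_eq_bot_iff]
      exact ⟨c, hc'⟩
    refine hins ⟨inferInstance, fun x hx => ?_⟩
    have : (⟨x, mem_separableClosure_iff.2 hx⟩ : L) ∈ (⊥ : IntermediateField E₀ L) :=
      hbot ▸ IntermediateField.mem_top
    obtain ⟨e, he⟩ := this
    exact ⟨e, congrArg (algebraMap L F) he⟩
  obtain ⟨a, ha, b, hb, hab⟩ := exists_sq_add_sq_mem_adjoin_forall_sq_ne k (K := K) (E := E)
    h2 (IsSeparable.map φ φ.injective (Algebra.IsSeparable.isSeparable E₀ β)) hβ0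
  rw [hrange] at ha hb
  obtain ⟨a, rfl⟩ := ha
  obtain ⟨b, rfl⟩ := hb
  obtain ⟨y, hy⟩ := hpyth ((a : F) * a + b * b)
    ((IsSumSq.mul_self _).add (IsSumSq.mul_self _))
  have hyL : y ^ 2 = algebraMap L F (a * a + b * b) := by
    rw [sq, ← hy]
    rfl
  have h2L : (2 : L) ≠ 0 := by
    have h := (_root_.map_ne_zero (algebraMap K L)).2 h2
    rwa [map_ofNat] at h
  have hyS : y ∈ L := mem_separableClosure_iff.2
    (IsSeparable.of_algebra_isSeparable_of_isSeparable E₀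
      (isSeparable_of_sq_eq_algebraMap h2L hyL))
  refine hab (φ ⟨y, hyS⟩) (hrange ▸ ⟨_, rfl⟩) ?_
  have hyy : (⟨y, hyS⟩ : L) ^ 2 = a ^ 2 + b ^ 2 := by
    rw [sq a, sq b]
    exact Subtype.ext hyL
  change φ _ ^ 2 = φ a ^ 2 + φ b ^ 2
  rw [← map_pow, hyy, map_add, map_pow, map_pow]

theorem mainTheorem3 {E : Type*} [Field E] (hchar : ringChar E ≠ 2)
    (k : Subfield E) (hfg : (⊤ : IntermediateField k E).FG) (htr : 1 ≤ Algebra.trdeg k E)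
    {E₀ : Type*} [Field E₀] [Algebra E E₀] [IsGalois E E₀]
    (hE₀ : IsPythagoreanField E₀ ∨ IsQuadraticallyClosedField E₀) :
    IsHereditarilyNonPythagorean E₀ := by
  intro F _ _ _ _ hins
  obtain ⟨k', t, ht, _⟩ := exists_transcendental_finiteDimensional_adjoin hfg fun h => by
    rw [trdeg_eq_zero_iff.2 h] at htr
    simp at htr
  obtain ⟨_, _⟩ := exists_isFractionRing_polynomial_adjoin ht
  let _ : Algebra E F := ((algebraMap E₀ F).comp (algebraMap E E₀)).toAlgebra
  have : IsScalarTower E E₀ F := IsScalarTower.of_algebraMap_eq fun _ => rfl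
  have : IsScalarTower k'⟮t⟯ E E₀ := IsScalarTower.of_algebraMap_eq fun _ => rfl
  have : IsScalarTower k'⟮t⟯ E F := IsScalarTower.of_algebraMap_eq fun _ => rfl
  have : IsScalarTower k'⟮t⟯ E₀ F := IsScalarTower.of_algebraMap_eq fun _ => rfl
  exact not_isPythagoreanField_of_normal_of_finiteDimensional k' (K := k'⟮t⟯) (E := E)
    (fun h => Ring.two_ne_zero hchar (congrArg (algebraMap k'⟮t⟯ E) h)) hins
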